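/- For a partition $\lambda$ of $n$, let $l(\lambda)$ be its number of parts, $d_\lambda$ the number of its distinct parts (the number of different values among its parts), and $f_\lambda$ the number of standard Young tableaux of shape $\lambda$. For positive integers $k,n$ put $$\sigma_k(n)=\sum_{\lambda\vdash n,\; l(\lambda)\le k} d_\lambda f_\lambda .$$ Let $C_i=\frac1{i+1}\binom{2i}{i}$ denote the $i$-th Catalan number and $M_n=\sum_{i\ge 0}\frac1{i+1}\binom{n}{2i}\binom{2i}{i}$ the $n$-th Motzkin number. Then for every positive integer $n$, $$\sigma_4(n)=C_{\lfloor n/2\rfloor+1}\,C_{\lceil n/2\rceil+1}-M_n .$$ -/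

import Mathlib

namespace KroneckerSYT

/-- The Young diagram of an integer partition (English convention): its row lengths are the parts
of `p` in weakly decreasing order. -/
def diagram {n : ℕ} (p : n.Partition) : YoungDiagram :=
  YoungDiagram.ofRowLens (p.parts.sort (· ≥ ·)) (p.parts.pairwise_sort (· ≥ ·)).sortedGE

/-- A semistandard Young tableau is standard if its entries are distinct elements of
`{1, ..., |μ|}`. -/
def IsStandard {μ : YoungDiagram} (T : SemistandardYoungTableau μ) : Prop :=
  Set.InjOn (fun c : ℕ × ℕ => T c.1 c.2) μ.cells ∧
    ∀ c ∈ μ.cells, T c.1 c.2 ∈ Finset.Icc 1 μ.card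

/-- Standard Young tableaux of shape `μ`. -/
abbrev StandardTableau (μ : YoungDiagram) : Type :=
  {T : SemistandardYoungTableau μ // IsStandard T}

/-- There are finitely many standard Young tableaux of a given shape, so that counting them with
`Nat.card` is meaningful. -/
instance finite_standardTableau (μ : YoungDiagram) : Finite (StandardTableau μ) := by
  refine Finite.of_injective
    (fun (T : StandardTableau μ) (c : μ.cells) =>
      (⟨T.1 c.1.1 c.1.2, T.2.2 c.1 c.2⟩ : Finset.Icc 1 μ.card)) ?_
  intro S T h
  apply Subtype.ext
  apply SemistandardYoungTableau.ext
  intro i j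
  by_cases hc : (i, j) ∈ μ
  · exact congrArg Subtype.val (congrFun h ⟨(i, j), hc⟩)
  · rw [S.1.zeros hc, T.1.zeros hc]

/-- `f_λ`: the number of standard Young tableaux of shape `λ`. -/
noncomputable def numSYT {n : ℕ} (p : n.Partition) : ℕ :=
  Nat.card (StandardTableau (diagram p))

/-- `l(λ)`: the number of parts of `λ`, counted with multiplicity. -/
def length {n : ℕ} (p : n.Partition) : ℕ :=
  p.parts.card

/-- `d_λ`: the number of distinct parts of `λ`. -/
def numDistinctParts {n : ℕ} (p : n.Partition) : ℕ :=
  p.parts.toFinset.card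

/-- `σ_k(n)`: the sum of `d_λ f_λ` over the partitions `λ` of `n` with at most `k` parts. -/
noncomputable def sigmaSum (k n : ℕ) : ℕ :=
  ∑ p : n.Partition with length p ≤ k, numDistinctParts p * numSYT p

/-- The Motzkin number `M_n = ∑_{i ≥ 0} 1 / (i + 1) * binom(n, 2i) * binom(2i, i)`, where
`1 / (i + 1) * binom(2i, i)` is the `i`-th Catalan number. The terms with `2i > n` vanish. -/
def motzkin (n : ℕ) : ℕ :=
  ∑ i ∈ Finset.range (n / 2 + 1), n.choose (2 * i) * catalan i

end KroneckerSYT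

/-! A diagram λ with at most k + 1 rows has d_λ covers with at most k + 1 rows, plus one more
exactly when it has at most k rows, since then a new row may be opened. Weighting by f_λ and using
the branching rule, `sigmaSum_succ` gives σ_{k+1}(n) = t_{k+1}(n+1) - t_k(n), where t_k(n) counts
the standard tableaux with n cells and at most k rows. For k = 3 it remains to find t_3(n) = M_n and
t_4(n) = C_{⌈n/2⌉} C_{⌊n/2⌋+1}.

Shifting the row lengths by (2, 1, 0) or (3, 2, 1, 0) turns tableaux into walks with strictly
decreasing coordinates. With a free endpoint these are counted by a Pfaffian of sign sums: it obeys
the step recursion, vanishes when adjacent coordinates coincide, and equals 1 inside the chamber at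
time 0. `sum_shapes_mul` transfers this to tableaux.

At the starting point, differences of sign sums are point counts of free walks, because sign(a+1) -
sign(a) = δ_{a,0} + δ_{a+1,0}. Plane walks split into two independent ±1 walks along the diagonals;
parity then factors the Pfaffian into Catalan numbers. -/

namespace KroneckerSYT

/-! ### Walks on the line and Catalan numbers -/

/-- The number of `n`-step walks on `ℤ` with steps `±1` from the origin to `j`. -/
def walkCount : ℕ → ℤ → ℤ
  | 0, j => if j = 0 then 1 else 0
  | n + 1, j => walkCount n (j - 1) + walkCount n (j + 1)

theorem walkCount_neg (n : ℕ) (j : ℤ) : walkCount n (-j) = walkCount n j := by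
  induction n generalizing j with
  | zero => simp [walkCount]
  | succ n ih =>
    rw [walkCount, walkCount, ← ih (j - 1), ← ih (j + 1), add_comm]
    congr 2 <;> ring

theorem walkCount_eq_zero_of_lt (n : ℕ) (j : ℤ) (h : (n : ℤ) < j) : walkCount n j = 0 := by
  induction n generalizing j with
  | zero => rw [walkCount, if_neg (by push_cast at h; omega)]
  | succ n ih =>
    push_cast at h
    rw [walkCount, ih _ (by omega), ih _ (by omega), add_zero]

theorem walkCount_eq_zero_of_odd (n : ℕ) (j : ℤ) (h : (n + j) % 2 = 1) : walkCount n j = 0 := by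
  induction n generalizing j with
  | zero => rw [walkCount, if_neg (by push_cast at h; omega)]
  | succ n ih =>
    push_cast at h
    rw [walkCount, ih _ (by omega), ih _ (by omega), add_zero]

theorem walkCount_eq_choose (n i : ℕ) : walkCount n (n - 2 * i) = n.choose i := by
  induction n generalizing i with
  | zero => cases i <;> simp [walkCount]; omega
  | succ n ih =>
    rw [walkCount]
    cases i with
    | zero =>
      rw [walkCount_eq_zero_of_lt n (_ + 1) (by push_cast; omega)]
      simpa using ih 0
    | succ i =>
      rw [Nat.choose_succ_succ, Nat.cast_add (n.choose i), ← ih i, ← ih (i + 1), add_comm]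
      push_cast
      congr 2 <;> ring

/-- The reflection-principle difference binom(2m, m) - binom(2m, m+1). The next two identities
follow by expanding one step of the walk. -/
theorem walkCount_zero_sub_two (m : ℕ) :
    walkCount (2 * m) 0 - walkCount (2 * m) 2 = catalan m := by
  have h0 := walkCount_eq_choose (2 * m) m
  have h1 := walkCount_eq_choose (2 * m) (m + 1)
  rw [show ((2 * m : ℕ) : ℤ) - 2 * (m : ℤ) = 0 by push_cast; ring] at h0
  rw [show ((2 * m : ℕ) : ℤ) - 2 * ((m + 1 : ℕ) : ℤ) = -2 by push_cast; ring,
    walkCount_neg] at h1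
  rw [h0, h1]
  have h2 := Nat.choose_succ_right_eq (2 * m) m
  rw [show 2 * m - m = m by omega] at h2
  have h3 := succ_mul_catalan_eq_centralBinom m
  rw [Nat.centralBinom_eq_two_mul_choose] at h3
  zify at h2 h3
  have hm : (m + 1 : ℤ) ≠ 0 := by positivity
  apply mul_left_cancel₀ hm
  linear_combination -h2 - h3

theorem walkCount_one_sub_three (m : ℕ) :
    walkCount (2 * m + 1) 1 - walkCount (2 * m + 1) 3 = catalan (m + 1) := by
  rw [← walkCount_zero_sub_two, show 2 * (m + 1) = 2 * m + 1 + 1 by ring]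
  rw [walkCount.eq_def _ 0, walkCount.eq_def _ 2]
  simp only
  rw [show (0 - 1 : ℤ) = -1 by norm_num, walkCount_neg]
  norm_num

theorem walkCount_zero_sub_four (m : ℕ) :
    walkCount (2 * m) 0 - walkCount (2 * m) 4 = catalan (m + 1) := by
  rw [← walkCount_one_sub_three, walkCount, walkCount]
  norm_num
  ring

/-! ### Lazy walks and Motzkin numbers -/

/-- The number of `n`-step walks on `ℤ` with steps `0`, `±1` from the origin to `j`. -/
def lazyWalkCount : ℕ → ℤ → ℤ
  | 0, j => if j = 0 then 1 else 0
  | n + 1, j => lazyWalkCount n (j - 1) + lazyWalkCount n j + lazyWalkCount n (j + 1)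

/-- Choose which k of the n steps are nonzero. -/
theorem lazyWalkCount_eq_sum (n : ℕ) (j : ℤ) :
    lazyWalkCount n j = ∑ k ∈ Finset.range (n + 1), (n.choose k : ℤ) * walkCount k j := by
  induction n generalizing j with
  | zero => simp [lazyWalkCount, walkCount]
  | succ n ih =>
    rw [lazyWalkCount, ih, ih, ih, Finset.sum_range_succ' _ (n + 1)]
    simp only [Nat.choose_succ_succ, Nat.cast_add, add_mul, Finset.sum_add_distrib, walkCount,
      mul_add]
    rw [Finset.sum_range_succ (fun k => (n.choose (k + 1) : ℤ) * walkCount k (j - 1)) n,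
      Finset.sum_range_succ (fun k => (n.choose (k + 1) : ℤ) * walkCount k (j + 1)) n,
      Nat.choose_succ_self]
    have h := Finset.sum_range_succ' (fun k => (n.choose k : ℤ) * walkCount k j) n
    simp only [walkCount, mul_add, Finset.sum_add_distrib] at h
    rw [h]
    simp
    ring

theorem motzkin_eq_sum (n : ℕ) :
    (motzkin n : ℤ) =
      ∑ k ∈ Finset.range (n + 1), (n.choose k : ℤ) * (walkCount k 0 - walkCount k 2) := by
  rw [motzkin, Nat.cast_sum]
  refine Finset.sum_of_injOn (fun i => 2 * i) (fun a _ b _ h => by simpa using h) ?_ ?_ ?_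
  · intro i hi
    simp at hi ⊢
    omega
  · intro k hk hk'
    have hodd : k % 2 = 1 := by
      by_contra hcon
      apply hk'
      simp at hk ⊢
      exact ⟨k / 2, by omega, by omega⟩
    rw [walkCount_eq_zero_of_odd k 0 (by omega), walkCount_eq_zero_of_odd k 2 (by omega)]
    simp
  · intro i _
    simp only [walkCount_zero_sub_two]
    push_cast
    rfl

/-! ### Sign sums and their differences -/

/-- The signed sum, over `n`-step walks with steps `0`, `±1` starting at `a`, of the sign of the
endpoint. -/
def lazySignSum : ℕ → ℤ → ℤ
  | 0, a => a.sign
  | n + 1, a => lazySignSum n (a - 1) + lazySignSum n a + lazySignSum n (a + 1)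

theorem lazySignSum_neg (n : ℕ) (a : ℤ) : lazySignSum n (-a) = -lazySignSum n a := by
  induction n generalizing a with
  | zero => simp [lazySignSum, Int.sign_neg]
  | succ n ih =>
    rw [lazySignSum, lazySignSum, show -a - 1 = -(a + 1) by ring,
      show -a + 1 = -(a - 1) by ring, ih, ih, ih]
    ring

theorem lazySignSum_zero_right (n : ℕ) : lazySignSum n 0 = 0 := by
  have := lazySignSum_neg n 0
  rw [neg_zero] at this
  omega

theorem sign_add_one_sub (a : ℤ) :
    (a + 1).sign - a.sign = (if a = 0 then 1 else 0) + (if a + 1 = 0 then 1 else 0) := by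
  rcases lt_trichotomy a (-1) with h | rfl | h
  · rw [Int.sign_eq_neg_one_of_neg (by omega), Int.sign_eq_neg_one_of_neg (by omega),
      if_neg (by omega), if_neg (by omega)]
    rfl
  · rfl
  · rcases eq_or_lt_of_le (show 0 ≤ a by omega) with rfl | h'
    · rfl
    · rw [Int.sign_eq_one_of_pos (by omega), Int.sign_eq_one_of_pos h',
        if_neg (by omega), if_neg (by omega)]
      rfl

/-- Both sides satisfy the same linear recursion in n, so only the jump of the sign function at n =
0 matters. -/
theorem lazySignSum_add_one_sub (n : ℕ) (a : ℤ) :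
    lazySignSum n (a + 1) - lazySignSum n a = lazyWalkCount n a + lazyWalkCount n (a + 1) := by
  induction n generalizing a with
  | zero => exact sign_add_one_sub a
  | succ n ih =>
    have h1 := ih (a - 1)
    have h2 := ih a
    have h3 := ih (a + 1)
    rw [sub_add_cancel] at h1
    simp only [lazySignSum, lazyWalkCount, add_sub_cancel_right]
    linear_combination h1 + h2 + h3

/-- The signed sum, over `n`-step walks in the square lattice starting at `(a, b)`, of the product
of the signs of the coordinates of the endpoint. -/
def signSum : ℕ → ℤ → ℤ → ℤ
  | 0, a, b => a.sign * b.sign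
  | n + 1, a, b =>
    signSum n (a - 1) b + signSum n (a + 1) b + signSum n a (b - 1) + signSum n a (b + 1)

theorem signSum_comm (n : ℕ) (a b : ℤ) : signSum n a b = signSum n b a := by
  induction n generalizing a b with
  | zero => simp [signSum, mul_comm]
  | succ n ih =>
    rw [signSum, signSum, ih (b - 1), ih (b + 1), ih b (a - 1), ih b (a + 1)]
    ring

theorem signSum_neg_left (n : ℕ) (a b : ℤ) : signSum n (-a) b = -signSum n a b := by
  induction n generalizing a b with
  | zero => simp [signSum, Int.sign_neg]
  | succ n ih =>
    rw [signSum, signSum, show -a - 1 = -(a + 1) by ring,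
      show -a + 1 = -(a - 1) by ring, ih, ih, ih, ih]
    ring

theorem signSum_zero_left (n : ℕ) (b : ℤ) : signSum n 0 b = 0 := by
  have := signSum_neg_left n 0 b
  rw [neg_zero] at this
  omega

theorem signSum_zero_right (n : ℕ) (a : ℤ) : signSum n a 0 = 0 := by
  rw [signSum_comm, signSum_zero_left]

/-- The number of `n`-step walks in the square lattice from the origin to `(a, b)`, as a product
of two one-dimensional counts in the coordinates `a + b` and `a - b`. -/
def planeWalkCount (n : ℕ) (a b : ℤ) : ℤ :=
  walkCount n (a + b) * walkCount n (a - b)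

theorem planeWalkCount_succ (n : ℕ) (a b : ℤ) :
    planeWalkCount (n + 1) a b =
      planeWalkCount n (a - 1) b + planeWalkCount n (a + 1) b +
        planeWalkCount n a (b - 1) + planeWalkCount n a (b + 1) := by
  simp only [planeWalkCount, walkCount]
  rw [show a - 1 + b = a + b - 1 by ring, show a - 1 - b = a - b - 1 by ring,
    show a + 1 + b = a + b + 1 by ring, show a + 1 - b = a - b + 1 by ring,
    show a + (b - 1) = a + b - 1 by ring, show a - (b - 1) = a - b + 1 by ring,
    show a + (b + 1) = a + b + 1 by ring, show a - (b + 1) = a - b - 1 by ring]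
  ring

theorem planeWalkCount_zero (a b : ℤ) :
    planeWalkCount 0 a b = (if a = 0 then 1 else 0) * (if b = 0 then 1 else 0) := by
  simp only [planeWalkCount, walkCount]
  split_ifs <;> first | rfl | omega

/-- At n = 0 this is the product of the jumps of the two signs; both sides then propagate by the
same four-term recursion. -/
theorem signSum_mixed_difference (n : ℕ) (a b : ℤ) :
    signSum n (a + 1) (b + 1) - signSum n a (b + 1) - signSum n (a + 1) b + signSum n a b =
      planeWalkCount n a b + planeWalkCount n a (b + 1) + planeWalkCount n (a + 1) b +
        planeWalkCount n (a + 1) (b + 1) := by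
  induction n generalizing a b with
  | zero =>
    simp only [planeWalkCount_zero, signSum]
    linear_combination ((b + 1).sign - b.sign) * sign_add_one_sub a +
      ((if a = 0 then 1 else 0) + (if a + 1 = 0 then 1 else 0)) * sign_add_one_sub b
  | succ n ih =>
    have h1 := ih (a - 1) b
    have h2 := ih (a + 1) b
    have h3 := ih a (b - 1)
    have h4 := ih a (b + 1)
    rw [sub_add_cancel] at h1 h3
    simp only [signSum, planeWalkCount_succ, add_sub_cancel_right]
    linear_combination h1 + h2 + h3 + h4

/-! ### Pfaffian counts of chamber walks -/

/-- For `a > b > c`, the number of `n`-step walks from `(a, b, c)` that increase one coordinate by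
`1` in each step and keep the coordinates strictly decreasing, as a Pfaffian. -/
def chamberWalks₃ (n : ℕ) (a b c : ℤ) : ℤ :=
  lazySignSum n (a - b) - lazySignSum n (a - c) + lazySignSum n (b - c)

/-- For `a > b > c > d`, the number of `n`-step walks from `(a, b, c, d)` that increase one
coordinate by `1` in each step and keep the coordinates strictly decreasing, as a Pfaffian. -/
def chamberWalks₄ (n : ℕ) (a b c d : ℤ) : ℤ :=
  signSum n (a - b) (c - d) - signSum n (a - c) (b - d) + signSum n (a - d) (b - c)

theorem chamberWalks₃_zero {a b c : ℤ} (h₁ : b < a) (h₂ : c < b) : chamberWalks₃ 0 a b c = 1 := by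
  simp only [chamberWalks₃, lazySignSum]
  rw [Int.sign_eq_one_of_pos (by omega), Int.sign_eq_one_of_pos (by omega),
    Int.sign_eq_one_of_pos (by omega)]
  rfl

/-- Raising one of three coordinates moves each pairwise difference by +1, -1 or 0, once each: a
lazy step. -/
theorem chamberWalks₃_succ (n : ℕ) (a b c : ℤ) :
    chamberWalks₃ (n + 1) a b c =
      chamberWalks₃ n (a + 1) b c + chamberWalks₃ n a (b + 1) c + chamberWalks₃ n a b (c + 1) := by
  simp only [chamberWalks₃, lazySignSum]
  ring_nf

theorem chamberWalks₃_self_left (n : ℕ) (a c : ℤ) : chamberWalks₃ n a a c = 0 := by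
  simp [chamberWalks₃, lazySignSum_zero_right]

theorem chamberWalks₃_self_right (n : ℕ) (a b : ℤ) : chamberWalks₃ n a b b = 0 := by
  simp [chamberWalks₃, lazySignSum_zero_right]

theorem chamberWalks₄_zero {a b c d : ℤ} (h₁ : b < a) (h₂ : c < b) (h₃ : d < c) :
    chamberWalks₄ 0 a b c d = 1 := by
  simp only [chamberWalks₄, signSum]
  rw [Int.sign_eq_one_of_pos (by omega), Int.sign_eq_one_of_pos (by omega),
    Int.sign_eq_one_of_pos (by omega), Int.sign_eq_one_of_pos (by omega),
    Int.sign_eq_one_of_pos (by omega), Int.sign_eq_one_of_pos (by omega)]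
  rfl

/-- For each pairing of the coordinates, the four possible increments are exactly the four lattice
steps of the pair of differences. -/
theorem chamberWalks₄_succ (n : ℕ) (a b c d : ℤ) :
    chamberWalks₄ (n + 1) a b c d =
      chamberWalks₄ n (a + 1) b c d + chamberWalks₄ n a (b + 1) c d +
        chamberWalks₄ n a b (c + 1) d + chamberWalks₄ n a b c (d + 1) := by
  simp only [chamberWalks₄, signSum]
  ring_nf

theorem chamberWalks₄_self_left (n : ℕ) (a c d : ℤ) : chamberWalks₄ n a a c d = 0 := by
  simp [chamberWalks₄, signSum_zero_left, signSum_comm n (a - d)]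

theorem chamberWalks₄_self_middle (n : ℕ) (a b d : ℤ) : chamberWalks₄ n a b b d = 0 := by
  simp [chamberWalks₄, signSum_zero_right]

theorem chamberWalks₄_self_right (n : ℕ) (a b c : ℤ) : chamberWalks₄ n a b c c = 0 := by
  simp [chamberWalks₄, signSum_zero_right]

theorem chamberWalks₃_origin (n : ℕ) : chamberWalks₃ n 2 1 0 = motzkin n := by
  have h0 := lazySignSum_add_one_sub n 0
  have h1 := lazySignSum_add_one_sub n 1
  norm_num [lazySignSum_zero_right] at h0 h1
  have h2 : chamberWalks₃ n 2 1 0 = lazyWalkCount n 0 - lazyWalkCount n 2 := by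
    simp only [chamberWalks₃]
    norm_num
    linear_combination h0 - h1
  rw [h2, motzkin_eq_sum, lazyWalkCount_eq_sum, lazyWalkCount_eq_sum, ← Finset.sum_sub_distrib]
  exact Finset.sum_congr rfl fun k _ => (mul_sub _ _ _).symm

theorem chamberWalks₄_origin_eq_walkCount (n : ℕ) :
    chamberWalks₄ n 3 2 1 0 =
      walkCount n 0 ^ 2 + walkCount n 1 ^ 2 + walkCount n 3 ^ 2 + walkCount n 4 * walkCount n 2 -
        walkCount n 2 * walkCount n 0 - 2 * walkCount n 3 * walkCount n 1 -
        walkCount n 4 * walkCount n 0 := by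
  have h00 := signSum_mixed_difference n 0 0
  have h10 := signSum_mixed_difference n 1 0
  have h20 := signSum_mixed_difference n 2 0
  have h01 := signSum_mixed_difference n 0 1
  have h11 := signSum_mixed_difference n 1 1
  have e1 := walkCount_neg n 1
  have e2 := walkCount_neg n 2
  norm_num [signSum_zero_left, signSum_zero_right, planeWalkCount, e1, e2]
    at h00 h10 h20 h01 h11
  simp only [chamberWalks₄]
  norm_num
  -- With S = `signSum n`, which vanishes on the axes, these mixed differences telescope to S(1,1) -
  -- S(2,2) + S(3,1).
  linear_combination h00 + h20 - h01 - h11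

theorem chamberWalks₄_origin (n : ℕ) :
    chamberWalks₄ n 3 2 1 0 = (catalan ((n + 1) / 2) : ℤ) * catalan (n / 2 + 1) := by
  rw [chamberWalks₄_origin_eq_walkCount]
  obtain ⟨m, rfl | rfl⟩ := Nat.even_or_odd' n
  -- Only even positions survive, leaving (w₀ - w₂)(w₀ - w₄).
  · rw [walkCount_eq_zero_of_odd (2 * m) 1 (by omega),
      walkCount_eq_zero_of_odd (2 * m) 3 (by omega), show (2 * m + 1) / 2 = m by omega,
      show 2 * m / 2 = m by omega, ← walkCount_zero_sub_two, ← walkCount_zero_sub_four]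
    ring
  -- Only odd positions survive, leaving (w₁ - w₃)².
  · rw [walkCount_eq_zero_of_odd (2 * m + 1) 0 (by push_cast; omega),
      walkCount_eq_zero_of_odd (2 * m + 1) 2 (by push_cast; omega),
      walkCount_eq_zero_of_odd (2 * m + 1) 4 (by push_cast; omega),
      show (2 * m + 1 + 1) / 2 = m + 1 by omega, show (2 * m + 1) / 2 = m by omega,
      ← walkCount_one_sub_three]
    ring

end KroneckerSYT

namespace KroneckerSYT

/-! ### The branching rule for standard tableaux -/

variable {μ ν : YoungDiagram}

theorem StandardTableau.entry_mono (T : StandardTableau ν) {c c' : ℕ × ℕ} (h : c' ≤ c)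
    (hc : c ∈ ν) : T.1 c'.1 c'.2 ≤ T.1 c.1 c.2 :=
  (T.1.row_weak_of_le h.2 (ν.up_left_mem h.1 le_rfl hc)).trans (T.1.col_weak h.1 hc)

/-- The cells of a standard tableau that do not hold the largest entry. -/
def StandardTableau.lowerShape (T : StandardTableau ν) : YoungDiagram where
  cells := {c ∈ ν.cells | T.1 c.1 c.2 < ν.card}
  isLowerSet := by
    intro c c' h hc
    simp only [Finset.coe_filter, Set.mem_ofPred_eq, YoungDiagram.mem_cells] at hc ⊢
    exact ⟨ν.up_left_mem h.1 h.2 hc.1, (T.entry_mono h hc.1).trans_lt hc.2⟩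

theorem StandardTableau.mem_lowerShape (T : StandardTableau ν) (c : ℕ × ℕ) :
    c ∈ T.lowerShape ↔ c ∈ ν ∧ T.1 c.1 c.2 < ν.card := by
  rw [← YoungDiagram.mem_cells]
  simp [StandardTableau.lowerShape]

theorem StandardTableau.lowerShape_le (T : StandardTableau ν) : T.lowerShape ≤ ν :=
  fun c hc => ((T.mem_lowerShape c).1 hc).1

theorem StandardTableau.exists_entry_eq (T : StandardTableau ν) {k : ℕ}
    (hk : k ∈ Finset.Icc 1 ν.card) : ∃ c ∈ ν, T.1 c.1 c.2 = k := by
  have himg : ν.cells.image (fun c => T.1 c.1 c.2) = Finset.Icc 1 ν.card := by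
    apply Finset.eq_of_subset_of_card_le
    · intro x hx
      obtain ⟨c, hc, rfl⟩ := Finset.mem_image.1 hx
      exact T.2.2 c hc
    · rw [Finset.card_image_of_injOn T.2.1]
      simp
  rw [← himg] at hk
  simpa using hk

theorem StandardTableau.card_lowerShape (T : StandardTableau ν) (h : 0 < ν.card) :
    T.lowerShape.card + 1 = ν.card := by
  obtain ⟨c, hc, hT⟩ := T.exists_entry_eq (k := ν.card) (Finset.mem_Icc.2 ⟨h, le_rfl⟩)
  have : T.lowerShape.cells = ν.cells.erase c := by
    ext x
    rw [YoungDiagram.mem_cells, T.mem_lowerShape, Finset.mem_erase, YoungDiagram.mem_cells]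
    constructor
    · rintro ⟨hx, hlt⟩
      refine ⟨?_, hx⟩
      rintro rfl
      omega
    · rintro ⟨hne, hx⟩
      refine ⟨hx, lt_of_le_of_ne (Finset.mem_Icc.1 (T.2.2 x hx)).2 fun he => hne ?_⟩
      exact T.2.1 hx hc (he.trans hT.symm)
  rw [YoungDiagram.card, this]
  exact Finset.card_erase_add_one hc

/-- The restriction of a standard tableau to the cells that do not hold its largest entry. -/
def StandardTableau.restrict (T : StandardTableau ν) (hT : T.lowerShape = μ)
    (h : μ.card + 1 = ν.card) : StandardTableau μ where
  val :=
    { entry := fun i j => if (i, j) ∈ μ then T.1 i j else 0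
      row_weak' := by
        intro i j₁ j₂ hj hmem
        rw [if_pos hmem, if_pos (μ.up_left_mem le_rfl hj.le hmem)]
        subst hT
        exact T.1.row_weak hj (T.lowerShape_le hmem)
      col_strict' := by
        intro i₁ i₂ j hi hmem
        rw [if_pos hmem, if_pos (μ.up_left_mem hi.le le_rfl hmem)]
        subst hT
        exact T.1.col_strict hi (T.lowerShape_le hmem)
      zeros' := fun hmem => if_neg hmem }
  property := by
    subst hT
    constructor
    · intro c hc c' hc' he
      refine T.2.1 (T.lowerShape_le hc) (T.lowerShape_le hc') ?_
      change (if c ∈ T.lowerShape then T.1 c.1 c.2 else 0) =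
        (if c' ∈ T.lowerShape then T.1 c'.1 c'.2 else 0) at he
      rwa [if_pos (show c ∈ T.lowerShape from hc), if_pos (show c' ∈ T.lowerShape from hc')] at he
    · intro c hc
      change (if c ∈ T.lowerShape then T.1 c.1 c.2 else 0) ∈ _
      rw [if_pos (show c ∈ T.lowerShape from hc)]
      have h1 := Finset.mem_Icc.1 (T.2.2 c (T.lowerShape_le hc))
      have h2 := ((T.mem_lowerShape c).1 hc).2
      rw [Finset.mem_Icc]
      omega

theorem StandardTableau.restrict_apply (T : StandardTableau ν) (hT : T.lowerShape = μ)
    (h : μ.card + 1 = ν.card) (i j : ℕ) :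
    (T.restrict hT h).1 i j = if (i, j) ∈ μ then T.1 i j else 0 := rfl

theorem eq_of_mem_of_notMem (hle : μ ≤ ν) (h : μ.card + 1 = ν.card) {c c' : ℕ × ℕ}
    (hc : c ∈ ν) (hc' : c' ∈ ν) (hn : c ∉ μ) (hn' : c' ∉ μ) : c = c' := by
  have hcard : (ν.cells \ μ.cells).card ≤ 1 := by
    rw [Finset.card_sdiff_of_subset (YoungDiagram.cells_subset_iff.2 hle)]
    change ν.card - μ.card ≤ 1
    omega
  exact Finset.card_le_one.1 hcard c (Finset.mem_sdiff.2 ⟨hc, hn⟩) c'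
    (Finset.mem_sdiff.2 ⟨hc', hn'⟩)

/-- The extension of a standard tableau by one cell holding the new largest entry. -/
def StandardTableau.extend (S : StandardTableau μ) (hle : μ ≤ ν) (h : μ.card + 1 = ν.card) :
    StandardTableau ν where
  val :=
    { entry := fun i j => if (i, j) ∈ μ then S.1 i j else if (i, j) ∈ ν then ν.card else 0
      row_weak' := by
        intro i j₁ j₂ hj hmem
        rw [if_pos hmem]
        by_cases h₂ : (i, j₂) ∈ μ
        · rw [if_pos h₂, if_pos (μ.up_left_mem le_rfl hj.le h₂)]
          exact S.1.row_weak hj h₂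
        · rw [if_neg h₂]
          split_ifs with h₁ h₁
          · have := Finset.mem_Icc.1 (S.2.2 _ h₁)
            simp only at this
            omega
          · exact le_rfl
          · omega
      col_strict' := by
        intro i₁ i₂ j hi hmem
        rw [if_pos hmem]
        by_cases h₂ : (i₂, j) ∈ μ
        · rw [if_pos h₂, if_pos (μ.up_left_mem hi.le le_rfl h₂)]
          exact S.1.col_strict hi h₂
        · rw [if_neg h₂]
          split_ifs with h₁ h₃
          · have := Finset.mem_Icc.1 (S.2.2 _ h₁)
            simp only at this
            omega
          · have := eq_of_mem_of_notMem hle h h₃ hmem h₁ h₂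
            simp only [Prod.mk.injEq] at this
            omega
          · omega
      zeros' := fun hmem => by rw [if_neg fun hμ => hmem (hle hμ), if_neg hmem] }
  property := by
    constructor
    · intro c hc c' hc' he
      change (if c ∈ μ then S.1 c.1 c.2 else if c ∈ ν then ν.card else 0) =
        (if c' ∈ μ then S.1 c'.1 c'.2 else if c' ∈ ν then ν.card else 0) at he
      rw [if_pos (show c ∈ ν from hc), if_pos (show c' ∈ ν from hc')] at he
      split_ifs at he with h₁ h₂ h₂
      · exact S.2.1 h₁ h₂ he
      · have := Finset.mem_Icc.1 (S.2.2 _ h₁)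
        omega
      · have := Finset.mem_Icc.1 (S.2.2 _ h₂)
        omega
      · exact eq_of_mem_of_notMem hle h hc hc' h₁ h₂
    · intro c hc
      change (if c ∈ μ then S.1 c.1 c.2 else if c ∈ ν then ν.card else 0) ∈ _
      rw [if_pos (show c ∈ ν from hc), Finset.mem_Icc]
      split_ifs with h₁
      · have := Finset.mem_Icc.1 (S.2.2 _ h₁)
        omega
      · omega

theorem StandardTableau.extend_apply (S : StandardTableau μ) (hle : μ ≤ ν)
    (h : μ.card + 1 = ν.card) (i j : ℕ) :
    (S.extend hle h).1 i j =
      if (i, j) ∈ μ then S.1 i j else if (i, j) ∈ ν then ν.card else 0 := rfl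

theorem StandardTableau.lowerShape_extend (S : StandardTableau μ) (hle : μ ≤ ν)
    (h : μ.card + 1 = ν.card) : (S.extend hle h).lowerShape = μ := by
  ext c
  rw [YoungDiagram.mem_cells, YoungDiagram.mem_cells, StandardTableau.mem_lowerShape, extend_apply]
  constructor
  · rintro ⟨hc, hlt⟩
    by_contra hn
    rw [if_neg hn, if_pos (show (c.1, c.2) ∈ ν from hc)] at hlt
    omega
  · intro hc
    have := Finset.mem_Icc.1 (S.2.2 _ hc)
    rw [if_pos (show (c.1, c.2) ∈ μ from hc)]
    exact ⟨hle hc, by omega⟩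

/-- Removing the largest entry identifies the standard tableaux of shape `ν` whose other entries
fill `μ` with the standard tableaux of shape `μ`. -/
def standardTableauFiberEquiv (hle : μ ≤ ν) (h : μ.card + 1 = ν.card) :
    {T : StandardTableau ν // T.lowerShape = μ} ≃ StandardTableau μ where
  toFun T := T.1.restrict T.2 h
  invFun S := ⟨S.extend hle h, S.lowerShape_extend hle h⟩
  left_inv := by
    rintro ⟨T, rfl⟩
    apply Subtype.ext
    apply Subtype.ext
    apply SemistandardYoungTableau.ext
    intro i j
    rw [StandardTableau.extend_apply, StandardTableau.restrict_apply]
    split_ifs with h₁ h₂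
    · rfl
    · rw [T.mem_lowerShape] at h₁
      have := Finset.mem_Icc.1 (T.2.2 _ h₂)
      simp only at this
      have h₃ : ¬ T.1 i j < ν.card := fun hlt => h₁ ⟨h₂, hlt⟩
      exact le_antisymm (not_lt.1 h₃) this.2
    · exact (T.1.zeros h₂).symm
  right_inv := by
    intro S
    apply Subtype.ext
    apply SemistandardYoungTableau.ext
    intro i j
    rw [StandardTableau.restrict_apply, StandardTableau.extend_apply]
    split_ifs with h₁
    · rfl
    · exact (S.1.zeros h₁).symm

/-- The branching rule: a standard tableau of shape `ν` restricts to one whose shape is obtained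
from `ν` by removing a cell. -/
theorem card_standardTableau_eq_sum (h : 0 < ν.card) (s : Finset YoungDiagram)
    (hs : ∀ μ, μ ∈ s ↔ μ ≤ ν ∧ μ.card + 1 = ν.card) :
    Nat.card (StandardTableau ν) = ∑ μ ∈ s, Nat.card (StandardTableau μ) := by
  classical
  have := Fintype.ofFinite (StandardTableau ν)
  rw [Nat.card_eq_fintype_card, ← Finset.card_univ,
    Finset.card_eq_sum_card_fiberwise (f := StandardTableau.lowerShape) (t := s)
      fun T _ => (hs _).2 ⟨T.lowerShape_le, T.card_lowerShape h⟩]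
  refine Finset.sum_congr rfl fun μ hμ => ?_
  rw [← Nat.card_congr (standardTableauFiberEquiv ((hs μ).1 hμ).1 ((hs μ).1 hμ).2),
    Nat.card_eq_fintype_card, Fintype.card_subtype]

theorem card_standardTableau_bot : Nat.card (StandardTableau ⊥) = 1 := by
  rw [Nat.card_eq_one_iff_unique]
  refine ⟨⟨fun S T => ?_⟩, ⟨⟨⟨fun _ _ => 0, fun _ _ => le_rfl, fun _ h => ?_, fun _ => rfl⟩, ?_⟩⟩⟩
  · apply Subtype.ext
    apply SemistandardYoungTableau.ext
    intro i j
    rw [S.1.zeros (YoungDiagram.notMem_bot _), T.1.zeros (YoungDiagram.notMem_bot _)]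
  · exact absurd h (YoungDiagram.notMem_bot _)
  · exact ⟨fun c hc => absurd hc (YoungDiagram.notMem_bot _),
      fun c hc => absurd hc (YoungDiagram.notMem_bot _)⟩

end KroneckerSYT

namespace KroneckerSYT

section Shapes

open scoped Classical

/-! ### Partitions as diagrams with boundedly many rows -/

theorem coe_rowLens_diagram {n : ℕ} (p : n.Partition) :
    ((diagram p).rowLens : Multiset ℕ) = p.parts := by
  rw [diagram, YoungDiagram.rowLens_ofRowLens_eq_self, Multiset.sort_eq]
  intro x hx
  exact p.parts_pos ((Multiset.mem_sort _).1 hx)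

theorem card_eq_sum_rowLens (μ : YoungDiagram) : μ.card = μ.rowLens.sum := by
  have h : μ.card = ∑ i ∈ Finset.range (μ.colLen 0), μ.rowLen i := by
    rw [YoungDiagram.card, Finset.card_eq_sum_card_fiberwise (f := Prod.fst)
      (t := Finset.range (μ.colLen 0))]
    · exact Finset.sum_congr rfl fun i _ => μ.rowLen_eq_card.symm
    · intro c hc
      rw [Finset.coe_range, Set.mem_Iio, ← YoungDiagram.mem_iff_lt_colLen]
      exact μ.up_left_mem le_rfl (Nat.zero_le _) hc
  rw [h]
  rfl

theorem rowLens_injective : Function.Injective YoungDiagram.rowLens := by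
  intro μ ν h
  exact YoungDiagram.equivListRowLens.injective (Subtype.ext h)

theorem diagram_injective (n : ℕ) : Function.Injective (diagram (n := n)) := by
  intro p q h
  apply Nat.Partition.ext
  rw [← coe_rowLens_diagram, ← coe_rowLens_diagram, h]

theorem card_diagram {n : ℕ} (p : n.Partition) : (diagram p).card = n := by
  rw [card_eq_sum_rowLens, ← Multiset.sum_coe, coe_rowLens_diagram, p.parts_sum]

theorem exists_diagram_eq (μ : YoungDiagram) : ∃ p : μ.card.Partition, diagram p = μ := by
  refine ⟨⟨μ.rowLens, fun hx => μ.pos_of_mem_rowLens _ hx, ?_⟩, ?_⟩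
  · rw [Multiset.sum_coe, card_eq_sum_rowLens]
  · apply rowLens_injective
    apply List.Perm.eq_of_sortedGE (YoungDiagram.rowLens_sorted _) (YoungDiagram.rowLens_sorted _)
    rw [← Multiset.coe_eq_coe, coe_rowLens_diagram]

theorem colLen_zero_le_iff (μ : YoungDiagram) (k : ℕ) : μ.colLen 0 ≤ k ↔ μ.rowLen k = 0 := by
  rw [← not_lt, ← YoungDiagram.mem_iff_lt_colLen, YoungDiagram.mem_iff_lt_rowLen]
  omega

theorem length_eq_colLen {n : ℕ} (p : n.Partition) : length p = (diagram p).colLen 0 := by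
  rw [length, ← coe_rowLens_diagram, Multiset.coe_card, YoungDiagram.length_rowLens]

/-- The Young diagrams with `n` cells and at most `k` rows. -/
noncomputable def shapes (k n : ℕ) : Finset YoungDiagram :=
  ({p : n.Partition | length p ≤ k} : Finset n.Partition).image diagram

theorem mem_shapes {k n : ℕ} {μ : YoungDiagram} :
    μ ∈ shapes k n ↔ μ.card = n ∧ μ.rowLen k = 0 := by
  simp only [shapes, Finset.mem_image, Finset.mem_filter, Finset.mem_univ, true_and,
    length_eq_colLen, colLen_zero_le_iff]
  constructor
  · rintro ⟨p, hp, rfl⟩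
    exact ⟨card_diagram p, hp⟩
  · rintro ⟨rfl, hk⟩
    obtain ⟨p, hp⟩ := exists_diagram_eq μ
    exact ⟨p, by rwa [hp], hp⟩

theorem sigmaSum_eq_sum_shapes (k n : ℕ) :
    sigmaSum k n =
      ∑ μ ∈ shapes k n, μ.rowLens.toFinset.card * Nat.card (StandardTableau μ) := by
  rw [sigmaSum, shapes, Finset.sum_image fun p _ q _ h => diagram_injective n h]
  refine Finset.sum_congr rfl fun p _ => ?_
  rw [numDistinctParts, numSYT, ← coe_rowLens_diagram]
  congr 2

theorem rowLen_mono {μ ν : YoungDiagram} (h : μ ≤ ν) (i : ℕ) : μ.rowLen i ≤ ν.rowLen i := by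
  by_contra! hlt
  have := h (YoungDiagram.mem_iff_lt_rowLen.2 hlt)
  exact lt_irrefl _ (YoungDiagram.mem_iff_lt_rowLen.1 this)

/-- The diagrams with at most `k` rows obtained from `μ` by adding a cell. -/
noncomputable def upperCovers (k : ℕ) (μ : YoungDiagram) : Finset YoungDiagram :=
  {ν ∈ shapes k (μ.card + 1) | μ ≤ ν}

/-- The branching rule read backwards: exchanging the sums turns removal of a cell from ν into
addition of a cell to μ. -/
theorem sum_shapes_succ (k n : ℕ) (H : YoungDiagram → ℤ) :
    ∑ ν ∈ shapes k (n + 1), (Nat.card (StandardTableau ν) : ℤ) * H ν =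
      ∑ μ ∈ shapes k n, (Nat.card (StandardTableau μ) : ℤ) * ∑ ν ∈ upperCovers k μ, H ν := by
  have h : ∀ ν ∈ shapes k (n + 1), (Nat.card (StandardTableau ν) : ℤ) * H ν =
      ∑ μ ∈ shapes k n with μ ≤ ν, (Nat.card (StandardTableau μ) : ℤ) * H ν := by
    intro ν hν
    rw [mem_shapes] at hν
    rw [card_standardTableau_eq_sum (by omega) {μ ∈ shapes k n | μ ≤ ν}, Nat.cast_sum,
      Finset.sum_mul]
    intro μ
    rw [Finset.mem_filter, mem_shapes]
    constructor
    · rintro ⟨⟨h₁, -⟩, h₂⟩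
      exact ⟨h₂, by omega⟩
    · rintro ⟨h₁, h₂⟩
      have := rowLen_mono h₁ k
      exact ⟨⟨by omega, by omega⟩, h₁⟩
  rw [Finset.sum_congr rfl h]
  simp only [Finset.mul_sum]
  refine Finset.sum_comm' fun ν μ => ?_
  simp only [upperCovers, Finset.mem_filter, mem_shapes]
  constructor
  · rintro ⟨⟨h₁, h₂⟩, ⟨h₃, h₄⟩, h₅⟩
    exact ⟨⟨⟨by omega, h₂⟩, h₅⟩, h₃, h₄⟩
  · rintro ⟨⟨⟨h₁, h₂⟩, h₅⟩, h₃, h₄⟩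
    exact ⟨⟨by omega, h₂⟩, ⟨h₃, h₄⟩, h₅⟩

theorem shapes_zero (k : ℕ) : shapes k 0 = {⊥} := by
  ext μ
  rw [mem_shapes, Finset.mem_singleton]
  constructor
  · rintro ⟨h, -⟩
    ext c
    rw [YoungDiagram.card, Finset.card_eq_zero] at h
    simp [h]
  · rintro rfl
    refine ⟨rfl, ?_⟩
    have := YoungDiagram.mem_iff_lt_rowLen (μ := ⊥) (i := k) (j := 0)
    simp at this
    exact this

/-- If `H m μ` satisfies the recursion of the number of ways to add `m` cells to `μ`, then it
pairs with the numbers of standard tableaux to a quantity depending on the final size only. -/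
theorem sum_shapes_mul (k : ℕ) (H : ℕ → YoungDiagram → ℤ)
    (hH : ∀ m μ, μ.rowLen k = 0 → H (m + 1) μ = ∑ ν ∈ upperCovers k μ, H m ν) (n m : ℕ) :
    ∑ μ ∈ shapes k n, (Nat.card (StandardTableau μ) : ℤ) * H m μ = H (n + m) ⊥ := by
  induction n generalizing m with
  | zero => rw [shapes_zero, Finset.sum_singleton, card_standardTableau_bot]; simp
  | succ n ih =>
    rw [sum_shapes_succ, show n + 1 + m = n + (m + 1) by ring, ← ih (m + 1)]
    exact Finset.sum_congr rfl fun μ hμ => by rw [hH m μ (mem_shapes.1 hμ).2]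

/-! ### Adding a cell -/

/-- A cell can be added to the `i`-th row of `μ`. -/
def IsAddable (μ : YoungDiagram) (i : ℕ) : Prop :=
  i = 0 ∨ μ.rowLen i < μ.rowLen (i - 1)

theorem IsAddable.rowLen_lt {μ : YoungDiagram} {i : ℕ} (h : IsAddable μ i) {i' : ℕ}
    (hi : i' < i) : μ.rowLen i < μ.rowLen i' := by
  rcases h with h | h
  · omega
  · exact h.trans_le (μ.rowLen_anti _ _ (by omega))

/-- The diagram obtained from `μ` by adding a cell to the `i`-th row. -/
def addCell (μ : YoungDiagram) (i : ℕ) (h : IsAddable μ i) : YoungDiagram where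
  cells := insert (i, μ.rowLen i) μ.cells
  isLowerSet := by
    rintro ⟨a, b⟩ ⟨a', b'⟩ ⟨ha : a' ≤ a, hb : b' ≤ b⟩ hmem
    simp only [Finset.coe_insert, Set.mem_insert_iff, Prod.mk.injEq, Finset.mem_coe,
      YoungDiagram.mem_cells] at hmem ⊢
    rcases hmem with ⟨rfl, rfl⟩ | hmem
    · rcases ha.eq_or_lt with rfl | ha
      · rcases hb.eq_or_lt with rfl | hb
        · exact Or.inl ⟨rfl, rfl⟩
        · exact Or.inr (YoungDiagram.mem_iff_lt_rowLen.2 hb)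
      · exact Or.inr (YoungDiagram.mem_iff_lt_rowLen.2 (hb.trans_lt (h.rowLen_lt ha)))
    · exact Or.inr (μ.up_left_mem ha hb hmem)

theorem notMem_rowLen (μ : YoungDiagram) (i : ℕ) : (i, μ.rowLen i) ∉ μ := by
  rw [YoungDiagram.mem_iff_lt_rowLen]
  exact lt_irrefl _

theorem card_addCell (μ : YoungDiagram) (i : ℕ) (h : IsAddable μ i) :
    (addCell μ i h).card = μ.card + 1 :=
  Finset.card_insert_of_notMem (notMem_rowLen μ i)

theorem le_addCell (μ : YoungDiagram) (i : ℕ) (h : IsAddable μ i) : μ ≤ addCell μ i h :=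
  YoungDiagram.cells_subset_iff.1 (Finset.subset_insert _ _)

theorem rowLen_addCell (μ : YoungDiagram) (i : ℕ) (h : IsAddable μ i) :
    (addCell μ i h).rowLen = Function.update μ.rowLen i (μ.rowLen i + 1) := by
  funext a
  refine eq_of_forall_lt_iff fun b => ?_
  rw [← YoungDiagram.mem_iff_lt_rowLen, ← YoungDiagram.mem_cells, addCell, Finset.mem_insert,
    Prod.mk.injEq, YoungDiagram.mem_cells, YoungDiagram.mem_iff_lt_rowLen]
  by_cases ha : a = i
  · subst ha
    rw [Function.update_self]
    omega
  · rw [Function.update_of_ne ha]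
    simp [ha]

theorem exists_addCell_eq {μ ν : YoungDiagram} (hle : μ ≤ ν) (hcard : ν.card = μ.card + 1) :
    ∃ i, ∃ h : IsAddable μ i, addCell μ i h = ν := by
  obtain ⟨⟨i, j⟩, hν, hμ⟩ : ∃ c ∈ ν.cells, c ∉ μ.cells :=
    Finset.exists_mem_notMem_of_card_lt_card (by
      change μ.card < ν.card
      omega)
  have huniq : ∀ c ∈ ν, c ∉ μ → c = (i, j) := fun c hc hc' =>
    eq_of_mem_of_notMem hle hcard.symm hc hν hc' hμ
  have hj : j = μ.rowLen i := by
    have h₁ : μ.rowLen i ≤ j := not_lt.1 fun h => hμ (YoungDiagram.mem_iff_lt_rowLen.2 h)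
    have h₂ := huniq (i, μ.rowLen i) (ν.up_left_mem le_rfl h₁ hν) (notMem_rowLen μ i)
    exact (Prod.mk.inj h₂).2.symm
  subst hj
  have hadd : IsAddable μ i := by
    by_contra hcon
    rw [IsAddable, not_or, not_lt] at hcon
    have h₁ : (i - 1, μ.rowLen i) ∉ μ := by
      rw [YoungDiagram.mem_iff_lt_rowLen]
      omega
    have h₂ := huniq _ (ν.up_left_mem (Nat.sub_le i 1) le_rfl hν) h₁
    have := (Prod.mk.inj h₂).1
    omega
  refine ⟨i, hadd, ?_⟩
  ext c
  rw [addCell, Finset.mem_insert]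
  constructor
  · rintro (rfl | hc)
    · exact hν
    · exact hle hc
  · intro hc
    by_cases hcμ : c ∈ μ.cells
    · exact Or.inr hcμ
    · exact Or.inl (huniq c hc hcμ)

theorem sum_upperCovers {k : ℕ} {μ : YoungDiagram} (hk : μ.rowLen k = 0) (F : (ℕ → ℕ) → ℤ) :
    ∑ ν ∈ upperCovers k μ, F ν.rowLen =
      ∑ i ∈ Finset.range k with IsAddable μ i,
        F (Function.update μ.rowLen i (μ.rowLen i + 1)) := by
  symm
  refine Finset.sum_bij (fun i hi => addCell μ i (Finset.mem_filter.1 hi).2) ?_ ?_ ?_ ?_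
  · intro i hi
    rw [Finset.mem_filter, Finset.mem_range] at hi
    rw [upperCovers, Finset.mem_filter, mem_shapes, rowLen_addCell,
      Function.update_of_ne (by omega)]
    exact ⟨⟨card_addCell μ i hi.2, hk⟩, le_addCell μ i hi.2⟩
  · intro i hi i' hi' h
    have h₁ := congrArg (fun ν => ν.rowLen i) h
    simp only [rowLen_addCell, Function.update_self] at h₁
    by_contra hne
    rw [Function.update_of_ne hne] at h₁
    omega
  · intro ν hν
    rw [upperCovers, Finset.mem_filter, mem_shapes] at hν
    obtain ⟨i, hi, rfl⟩ := exists_addCell_eq hν.2 hν.1.1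
    refine ⟨i, ?_, rfl⟩
    rw [Finset.mem_filter, Finset.mem_range]
    refine ⟨?_, hi⟩
    by_contra hcon
    have h₁ := hν.1.2
    have h₂ := (addCell μ i hi).rowLen_anti _ _ (not_lt.1 hcon)
    rw [rowLen_addCell, Function.update_self] at h₂
    rw [rowLen_addCell] at h₁
    omega
  · intro i hi
    rw [rowLen_addCell]

/-! ### Distinct parts and the number of covers -/

theorem card_image_range_of_antitone (r : ℕ → ℕ) (hr : Antitone r) (k : ℕ) :
    ((Finset.range (k + 1)).image r).card =
      (Finset.range k |>.filter fun i => r (i + 1) < r i).card + 1 := by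
  induction k with
  | zero => simp
  | succ k ih =>
    rw [Finset.range_add_one (n := k + 1), Finset.image_insert, Finset.range_add_one (n := k),
      Finset.filter_insert]
    rw [← Finset.range_add_one]
    split_ifs with h
    · rw [Finset.card_insert_of_notMem, ih, Finset.card_insert_of_notMem]
      · simp
      · rw [Finset.mem_image]
        rintro ⟨i, hi, he⟩
        have := hr (show i ≤ k by simpa [Nat.lt_succ_iff] using hi)
        omega
    · rw [Finset.insert_eq_of_mem, ih]
      exact Finset.mem_image.2 ⟨k, by simp, le_antisymm (not_lt.1 h) (hr (Nat.le_succ k))⟩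

/-- Rows 0 to k take one more value than there are strict descents; the extra value is 0, attained
at row k, and is not a part. -/
theorem card_toFinset_rowLens {k : ℕ} {μ : YoungDiagram} (hk : μ.rowLen k = 0) :
    μ.rowLens.toFinset.card =
      (Finset.range k |>.filter fun i => μ.rowLen (i + 1) < μ.rowLen i).card := by
  have h : μ.rowLens.toFinset = ((Finset.range (k + 1)).image μ.rowLen).erase 0 := by
    ext x
    simp only [YoungDiagram.rowLens, List.mem_toFinset, List.mem_map, List.mem_range,
      Finset.mem_erase, Finset.mem_image, Finset.mem_range, ← YoungDiagram.mem_iff_lt_colLen,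
      YoungDiagram.mem_iff_lt_rowLen]
    constructor
    · rintro ⟨i, hi, rfl⟩
      refine ⟨by omega, i, ?_, rfl⟩
      by_contra hcon
      have := μ.rowLen_anti k i (by omega)
      omega
    · rintro ⟨hx, i, -, rfl⟩
      exact ⟨i, by omega, rfl⟩
  rw [h, Finset.card_erase_of_mem (Finset.mem_image.2 ⟨k, by simp, hk⟩),
    card_image_range_of_antitone _ fun a b hab => μ.rowLen_anti a b hab]
  rfl

theorem card_upperCovers {k : ℕ} {μ : YoungDiagram} (hk : μ.rowLen (k + 1) = 0) :
    (upperCovers (k + 1) μ).card =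
      μ.rowLens.toFinset.card + if μ.rowLen k = 0 then 1 else 0 := by
  have h := sum_upperCovers hk fun _ => 1
  rw [Finset.sum_const, Finset.sum_const, nsmul_eq_mul, nsmul_eq_mul, mul_one, mul_one,
    Nat.cast_inj] at h
  -- Row 0 always accepts a cell; row i + 1 does exactly at a descent from row i.
  have h' : (Finset.range (k + 1) |>.filter (IsAddable μ)) =
      insert 0 ((Finset.range k |>.filter fun i => μ.rowLen (i + 1) < μ.rowLen i).image
        Nat.succ) := by
    ext i
    cases i with
    | zero => simp [IsAddable]
    | succ i => simp [IsAddable]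
  rw [h, h', Finset.card_insert_of_notMem (by simp),
    Finset.card_image_of_injective _ Nat.succ_injective, card_toFinset_rowLens hk,
    Finset.range_add_one, Finset.filter_insert, hk]
  split_ifs with h₁ h₂ h₂
  · omega
  · rw [Finset.card_insert_of_notMem (by simp), add_zero]
  · rfl
  · omega

theorem sigmaSum_succ (k n : ℕ) :
    (sigmaSum (k + 1) n : ℤ) =
      ∑ μ ∈ shapes (k + 1) (n + 1), (Nat.card (StandardTableau μ) : ℤ) -
        ∑ μ ∈ shapes k n, (Nat.card (StandardTableau μ) : ℤ) := by
  have h := sum_shapes_succ (k + 1) n fun _ => 1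
  simp only [mul_one, Finset.sum_const, nsmul_eq_mul] at h
  have hsub : shapes k n = {μ ∈ shapes (k + 1) n | μ.rowLen k = 0} := by
    ext μ
    simp only [Finset.mem_filter, mem_shapes]
    constructor
    · rintro ⟨h₁, h₂⟩
      have := μ.rowLen_anti k (k + 1) (Nat.le_succ k)
      exact ⟨⟨h₁, by omega⟩, h₂⟩
    · rintro ⟨⟨h₁, -⟩, h₂⟩
      exact ⟨h₁, h₂⟩
  rw [h, hsub, Finset.sum_filter, ← Finset.sum_sub_distrib, sigmaSum_eq_sum_shapes, Nat.cast_sum]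
  refine Finset.sum_congr rfl fun μ hμ => ?_
  rw [card_upperCovers (mem_shapes.1 hμ).2]
  split_ifs <;> push_cast <;> ring

/-! ### Counting tableaux with at most three or four rows -/

theorem sum_card_standardTableau_three (n : ℕ) :
    ∑ μ ∈ shapes 3 n, (Nat.card (StandardTableau μ) : ℤ) = motzkin n := by
  let F : ℕ → (ℕ → ℕ) → ℤ := fun m r => chamberWalks₃ m (r 0 + 2) (r 1 + 1) (r 2)
  have hF := sum_shapes_mul 3 (fun m μ => F m μ.rowLen) (fun m μ hμ => ?_) n 0
  · have hbot : (⊥ : YoungDiagram).rowLen = fun _ => 0 :=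
      funext fun i => (mem_shapes.1 (by rw [shapes_zero]; simp : ⊥ ∈ shapes i 0)).2
    rw [hbot, add_zero] at hF
    simp only [F, Nat.cast_zero, zero_add] at hF
    rw [← chamberWalks₃_origin, ← hF]
    refine Finset.sum_congr rfl fun μ _ => ?_
    have h₁ := μ.rowLen_anti 0 1 (by omega)
    have h₂ := μ.rowLen_anti 1 2 (by omega)
    rw [chamberWalks₃_zero (by omega) (by omega), mul_one]
  · rw [sum_upperCovers hμ (F m), Finset.sum_filter]
    have h₁ := μ.rowLen_anti 0 1 (by omega)
    have h₂ := μ.rowLen_anti 1 2 (by omega)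
    simp only [F, chamberWalks₃_succ, Finset.sum_range_succ, Finset.sum_range_zero, zero_add]
    congr 1
    congr 1
    · rw [if_pos (show IsAddable μ 0 from Or.inl rfl)]
      simp [Function.update]
      ring_nf
    -- When row 1 is not addable it equals row 0, so the shifted coordinates collide after the step
    -- and the Pfaffian vanishes; the later rows work alike.
    · split_ifs with h
      · simp [Function.update]
      · simp only [IsAddable, Nat.sub_self] at h
        rw [show (μ.rowLen 1 : ℤ) + 1 + 1 = μ.rowLen 0 + 2 by omega, chamberWalks₃_self_left]
    · split_ifs with h
      · simp [Function.update]
      · simp only [IsAddable, Nat.add_one_sub_one] at h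
        rw [show (μ.rowLen 2 : ℤ) + 1 = μ.rowLen 1 + 1 by omega, chamberWalks₃_self_right]

theorem sum_card_standardTableau_four (n : ℕ) :
    ∑ μ ∈ shapes 4 n, (Nat.card (StandardTableau μ) : ℤ) =
      catalan ((n + 1) / 2) * catalan (n / 2 + 1) := by
  let F : ℕ → (ℕ → ℕ) → ℤ := fun m r => chamberWalks₄ m (r 0 + 3) (r 1 + 2) (r 2 + 1) (r 3)
  have hF := sum_shapes_mul 4 (fun m μ => F m μ.rowLen) (fun m μ hμ => ?_) n 0
  · have hbot : (⊥ : YoungDiagram).rowLen = fun _ => 0 :=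
      funext fun i => (mem_shapes.1 (by rw [shapes_zero]; simp : ⊥ ∈ shapes i 0)).2
    rw [hbot, add_zero] at hF
    simp only [F, Nat.cast_zero, zero_add] at hF
    rw [← chamberWalks₄_origin, ← hF]
    refine Finset.sum_congr rfl fun μ _ => ?_
    have h₁ := μ.rowLen_anti 0 1 (by omega)
    have h₂ := μ.rowLen_anti 1 2 (by omega)
    have h₃ := μ.rowLen_anti 2 3 (by omega)
    rw [chamberWalks₄_zero (by omega) (by omega) (by omega), mul_one]
  · rw [sum_upperCovers hμ (F m), Finset.sum_filter]
    have h₁ := μ.rowLen_anti 0 1 (by omega)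
    have h₂ := μ.rowLen_anti 1 2 (by omega)
    have h₃ := μ.rowLen_anti 2 3 (by omega)
    simp only [F, chamberWalks₄_succ, Finset.sum_range_succ, Finset.sum_range_zero, zero_add]
    congr 1
    congr 1
    congr 1
    · rw [if_pos (show IsAddable μ 0 from Or.inl rfl)]
      simp [Function.update]
      ring_nf
    · split_ifs with h
      · simp [Function.update]
        ring_nf
      · simp only [IsAddable, Nat.sub_self] at h
        rw [show (μ.rowLen 1 : ℤ) + 2 + 1 = μ.rowLen 0 + 3 by omega, chamberWalks₄_self_left]
    · split_ifs with h
      · simp [Function.update]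
      · simp only [IsAddable, Nat.add_one_sub_one] at h
        rw [show (μ.rowLen 2 : ℤ) + 1 + 1 = μ.rowLen 1 + 2 by omega, chamberWalks₄_self_middle]
    · split_ifs with h
      · simp [Function.update]
      · simp only [IsAddable, Nat.add_one_sub_one] at h
        rw [show (μ.rowLen 3 : ℤ) + 1 = μ.rowLen 2 + 1 by omega, chamberWalks₄_self_right]

end Shapes

end KroneckerSYT

theorem mainTheorem8 (n : ℕ) (hn : 0 < n) :
    (KroneckerSYT.sigmaSum 4 n : ℤ) =
      (catalan (n / 2 + 1) : ℤ) * (catalan ((n + 1) / 2 + 1) : ℤ) -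
        (KroneckerSYT.motzkin n : ℤ) := by
  rw [KroneckerSYT.sigmaSum_succ, KroneckerSYT.sum_card_standardTableau_three,
    KroneckerSYT.sum_card_standardTableau_four, show (n + 1 + 1) / 2 = n / 2 + 1 by omega]
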